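/- Let $\mathbf{Ab}$ be the category of abelian groups, let $S^1=\{z\in\mathbb{C} : |z|=1\}$ be the circle group, and for an abelian group $A$ let $\mathbf{Ab}(A,S^1)$ be the abelian group of all group homomorphisms $A\to S^1$ with pointwise structure. The functor $\mathbf{Ab}(-,S^1)\colon \mathbf{Ab}\to\mathbf{Ab}^{\mathrm{op}}$ is left adjoint to $\mathbf{Ab}(-,S^1)\colon \mathbf{Ab}^{\mathrm{op}}\to\mathbf{Ab}$ via the natural bijection $\mathbf{Ab}(B,\mathbf{Ab}(A,S^1))\cong\mathbf{Ab}(A,\mathbf{Ab}(B,S^1))$ interchanging arguments. The monad on $\mathbf{Ab}$ induced by this adjunction, $A\mapsto \mathbf{Ab}(\mathbf{Ab}(A,S^1),S^1)$, is called the double dualization monad. Let $\{S^1\times S^1\}$ be the one-object full subcategory, on the torus $S^1\times S^1$, of the category of compact Hausdorff abelian groups and continuous group homomorphisms, and let $U\colon\{S^1\times S^1\}\to\mathbf{Ab}$ be the functor that forgets the topology. For a functor $F\colon\mathcal{A}\to\mathcal{C}$ whose right Kan extension $\operatorname{Ran}_F F$ along itself exists, with counit $\varphi\colon(\operatorname{Ran}_F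 F)F\to F$, the codensity monad of $F$ is the monad $(\operatorname{Ran}_F F,\eta,\mu)$ whose unit $\eta$ and multiplication $\mu$ are the natural transformations corresponding, under the universal property of $\operatorname{Ran}_F F$, to $\mathrm{id}_F\colon F\to F$ and to $\varphi\circ(\operatorname{Ran}_F F)\varphi\colon(\operatorname{Ran}_F F)(\operatorname{Ran}_F F)F\to F$, respectively. Theorem. The right Kan extension of $U$ along itself exists and is pointwise, i.e. $(\operatorname{Ran}_U U)X=\lim_{f\colon X\to UT}UT$ for every abelian group $X$, where $T=S^1\times S^1$; and the codensity monad of $U$ is isomorphic, as a monad, to the double dualization monad on $\mathbf{Ab}$ with respect to $S^1$. -/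

import Mathlib

open CategoryTheory

universe v₁ v₂ u₁ u₂ u

noncomputable section

namespace Codensity

/-! ### The codensity monad of a functor -/

section CodensityMonad

variable {A : Type u₁} [Category.{v₁} A] {C : Type u₂} [Category.{v₂} C]
variable (F : A ⥤ C) [F.HasRightKanExtension F]

/-- The right Kan extension `Ran_F F` of `F` along itself. -/
abbrev ran : C ⥤ C := F.rightKanExtension F

/-- The counit `φ : (Ran_F F) F ⟶ F`. -/
abbrev ranCounit : F ⋙ ran F ⟶ F := F.rightKanExtensionCounit F

/-- The unit `Id ⟶ Ran_F F`, corresponding to `id : F ⟶ F`. -/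
def codensityUnit : 𝟭 C ⟶ ran F :=
  (ran F).liftOfIsRightKanExtension (ranCounit F) (𝟭 C) (Functor.rightUnitor F).hom

/-- The multiplication `(Ran_F F) (Ran_F F) ⟶ Ran_F F`, corresponding to
`(Ran_F F) (Ran_F F) F ⟶ (Ran_F F) F ⟶ F`, i.e. to `φ ∘ (Ran_F F) φ`. -/
def codensityMul : ran F ⋙ ran F ⟶ ran F :=
  (ran F).liftOfIsRightKanExtension (ranCounit F) (ran F ⋙ ran F)
    ((Functor.associator F (ran F) (ran F)).inv ≫
      Functor.whiskerRight (ranCounit F) (ran F) ≫ ranCounit F)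

theorem codensityUnit_fac (X : A) :
    (codensityUnit F).app (F.obj X) ≫ (ranCounit F).app X = 𝟙 (F.obj X) := by
  simp [codensityUnit]

theorem codensityMul_fac (X : A) :
    (codensityMul F).app (F.obj X) ≫ (ranCounit F).app X =
      (ran F).map ((ranCounit F).app X) ≫ (ranCounit F).app X := by
  simp [codensityMul]

theorem codensity_left_unit :
    Functor.whiskerLeft (ran F) (codensityUnit F) ≫ codensityMul F =
      (Functor.rightUnitor (ran F)).hom := by
  apply (ran F).hom_ext_of_isRightKanExtension (ranCounit F)
  ext X
  have h := (codensityUnit F).naturality ((ranCounit F).app X)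
  have h1 := codensityUnit_fac F X
  have h2 := codensityMul_fac F X
  simp only [Functor.id_obj, Functor.id_map, Functor.comp_obj] at h h1 h2
  simp only [NatTrans.comp_app, Functor.whiskerLeft_app, Functor.rightUnitor_hom_app,
    Category.assoc, Functor.comp_obj, Functor.id_obj, Category.id_comp]
  rw [h2, ← Category.assoc, ← h, Category.assoc, h1, Category.comp_id]

theorem codensity_right_unit :
    Functor.whiskerRight (codensityUnit F) (ran F) ≫ codensityMul F =
      (Functor.leftUnitor (ran F)).hom := by
  apply (ran F).hom_ext_of_isRightKanExtension (ranCounit F)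
  ext X
  have h1 := codensityUnit_fac F X
  have h2 := codensityMul_fac F X
  simp only [Functor.id_obj, Functor.comp_obj] at h1 h2
  simp only [NatTrans.comp_app, Functor.whiskerLeft_app, Functor.whiskerRight_app,
    Functor.leftUnitor_hom_app, Category.assoc, Functor.comp_obj, Functor.id_obj,
    Category.id_comp]
  rw [h2, ← Category.assoc, ← Functor.map_comp, h1, CategoryTheory.Functor.map_id, Category.id_comp]

theorem codensity_assoc :
    Functor.whiskerRight (codensityMul F) (ran F) ≫ codensityMul F =
      (Functor.associator (ran F) (ran F) (ran F)).hom ≫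
        Functor.whiskerLeft (ran F) (codensityMul F) ≫ codensityMul F := by
  apply (ran F).hom_ext_of_isRightKanExtension (ranCounit F)
  ext X
  have h := (codensityMul F).naturality ((ranCounit F).app X)
  have h2 := codensityMul_fac F X
  simp only [Functor.comp_obj, Functor.comp_map] at h h2
  simp only [NatTrans.comp_app, Functor.whiskerLeft_app, Functor.whiskerRight_app,
    Functor.associator_hom_app, Category.assoc, Functor.comp_obj, Category.id_comp]
  rw [h2, ← Category.assoc, ← Functor.map_comp, h2, Functor.map_comp, Category.assoc]
  rw [← Category.assoc ((codensityMul F).app _), ← h, Category.assoc, h2]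

/-- The codensity monad `(Ran_F F, η, μ)` of a functor `F` whose right Kan extension along
itself exists. -/
def codensityMonad : Monad C where
  toFunctor := ran F
  η := codensityUnit F
  μ := codensityMul F
  assoc X := by simpa using NatTrans.congr_app (codensity_assoc F) X
  left_unit X := by simpa using NatTrans.congr_app (codensity_left_unit F) X
  right_unit X := by simpa using NatTrans.congr_app (codensity_right_unit F) X

end CodensityMonad

/-! ### The double dualization monad on abelian groups -/

/-- The functor `Ab(-, S¹) : Abᵒᵖ ⥤ Ab`: all group homomorphisms into the circle group, with
the pointwise group structure, acting on morphisms by precomposition. -/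
def dual : CommGrpCat.{u}ᵒᵖ ⥤ CommGrpCat.{u} where
  obj B := CommGrpCat.of (B.unop →* Circle)
  map f := CommGrpCat.ofHom (MonoidHom.compHom' f.unop.hom)

/-- The bijection `Ab(B, Ab(A, S¹)) ≃ Ab(A, Ab(B, S¹))` interchanging the two arguments. -/
def dualHomEquiv (A : CommGrpCat.{u}) (B : CommGrpCat.{u}ᵒᵖ) :
    (dual.rightOp.obj A ⟶ B) ≃ (A ⟶ dual.obj B) where
  toFun f := CommGrpCat.ofHom (MonoidHom.flip (M := B.unop) (N := A) (P := Circle) f.unop.hom)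
  invFun g :=
    (CommGrpCat.ofHom (MonoidHom.flip (M := A) (N := B.unop) (P := Circle) g.hom)).op
  left_inv _ := rfl
  right_inv _ := rfl

/-- The dual adjunction `Ab(-, S¹) ⊣ Ab(-, S¹) : Abᵒᵖ ⥤ Ab`. -/
def dualAdjunction : dual.{u}.rightOp ⊣ dual.{u} :=
  Adjunction.mkOfHomEquiv
    { homEquiv := dualHomEquiv
      homEquiv_naturality_left_symm := fun _ _ => rfl
      homEquiv_naturality_right := fun _ _ => rfl }

/-- The double dualization monad `A ↦ Ab(Ab(A, S¹), S¹)`, induced by the dual adjunction. -/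
def doubleDualizationMonad : Monad CommGrpCat.{u} := dualAdjunction.toMonad

/-! ### The torus as a one-object category and its forgetful functor -/

/-- Compact Hausdorff abelian groups. -/
structure CHAb : Type (u + 1) where
  carrier : Type u
  [commGroup : CommGroup carrier]
  [topologicalSpace : TopologicalSpace carrier]
  [isTopologicalGroup : IsTopologicalGroup carrier]
  [compactSpace : CompactSpace carrier]
  [t2Space : T2Space carrier]

attribute [instance] CHAb.commGroup CHAb.topologicalSpace CHAb.isTopologicalGroup
  CHAb.compactSpace CHAb.t2Space

/-- Morphisms of `CHAb` are the continuous group homomorphisms. -/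
instance : Category CHAb.{u} where
  Hom G H := G.carrier →ₜ* H.carrier
  id G := ContinuousMonoidHom.id G.carrier
  comp f g := ContinuousMonoidHom.comp g f

/-- The functor from compact Hausdorff abelian groups to abelian groups forgetting the
topology. -/
def CHAb.forgetToAb : CHAb.{u} ⥤ CommGrpCat.{u} where
  obj G := CommGrpCat.of G.carrier
  map f := CommGrpCat.ofHom (ContinuousMonoidHom.toMonoidHom f)

instance : IsTopologicalGroup (ULift.{u} (Circle × Circle)) where
  continuous_mul := continuous_uliftUp.comp
    ((continuous_uliftDown.comp continuous_fst).mul (continuous_uliftDown.comp continuous_snd))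
  continuous_inv := continuous_uliftUp.comp continuous_uliftDown.inv

/-- The torus `S¹ × S¹` with its product topology (moved to the universe `u`). -/
def torus : CHAb.{u} where
  carrier := ULift.{u} (Circle × Circle)

/-- The one-object full subcategory `{S¹ × S¹}` of `CHAb`. -/
abbrev TorusCat : Type := InducedCategory CHAb.{u} (fun _ : Unit => torus.{u})

/-- The forgetful functor `U : {S¹ × S¹} ⥤ Ab`: the inclusion into `CHAb` followed by the
functor forgetting the topology. -/
def torusForget : TorusCat.{u} ⥤ CommGrpCat.{u} :=
  inducedFunctor (fun _ : Unit => torus.{u}) ⋙ CHAb.forgetToAb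

end Codensity

end

/-!
Pontryagin duality identifies the group of continuous characters of the torus `T` with `ℤ²`, and
the continuous endomorphisms of `T` with all endomorphisms of `ℤ²`. The full subcategory `{ℤ²}` is
dense in `Ab`: a family of maps out of an abelian group `Y` that is compatible with homomorphisms
`ℤ² → ℤ²` is a homomorphism, since additivity only involves two elements of `Y` at a time. Hence
`K : T ↦ ℤ²` is codense as a functor to `Abᵒᵖ`. As `T = Ab(ℤ², S¹)`, the functor `U` is `K` followed
by the right adjoint `R = Ab(-, S¹)` of `L = Ab(-, S¹)`. For any adjunction `L ⊣ R` and any codense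
`K`, transposing cones along the adjunction shows that `RL` is the pointwise right Kan extension of
`RK` along itself, and that its codensity monad is the monad of the adjunction.
-/

noncomputable section

namespace Codensity

open Limits Opposite

section Recognition

variable {A : Type u₁} [Category.{v₁} A] {C : Type u₂} [Category.{v₂} C]
  (F : A ⥤ C) [F.HasRightKanExtension F]

/-- A monad carried by a right Kan extension of `F` along itself is the codensity monad of `F` as
soon as its unit and its multiplication satisfy the equations that characterise those of the
codensity monad. -/
def codensityMonadIso (M : Monad C) (ε : F ⋙ M.toFunctor ⟶ F)
    [M.toFunctor.IsRightKanExtension ε]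
    (hη : ∀ X, M.η.app (F.obj X) ≫ ε.app X = 𝟙 (F.obj X))
    (hμ : ∀ X, M.μ.app (F.obj X) ≫ ε.app X = M.map (ε.app X) ≫ ε.app X) :
    M ≅ codensityMonad F :=
  let e : M.toFunctor ≅ ran F := Functor.rightKanExtensionUnique _ ε _ (ranCounit F)
  have he (X : A) : e.hom.app (F.obj X) ≫ (ranCounit F).app X = ε.app X := by
    simp [e, Functor.rightKanExtensionUnique]
  have unit_comp : M.η ≫ e.hom = codensityUnit F := by
    apply (ran F).hom_ext_of_isRightKanExtension (ranCounit F)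
    ext X
    have fac := codensityUnit_fac F X
    simp only [Functor.id_obj] at fac
    simp [he, hη, fac]
  have mul_comp : M.μ ≫ e.hom = (Functor.whiskerRight e.hom M.toFunctor ≫
      Functor.whiskerLeft (ran F) e.hom) ≫ codensityMul F := by
    apply (ran F).hom_ext_of_isRightKanExtension (ranCounit F)
    ext X
    have fac := codensityMul_fac F X
    simp only [Functor.comp_obj] at fac
    simp only [NatTrans.comp_app, Functor.whiskerLeft_app, Functor.whiskerRight_app,
      Category.assoc, he, hμ, fac, ← NatTrans.naturality_assoc]
    rw [← Functor.map_comp_assoc, he]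
  MonadIso.mk e (NatTrans.congr_app unit_comp) (NatTrans.congr_app mul_comp)

end Recognition

section Codense

variable {A : Type u₁} [Category.{v₁} A] {B : Type u₂} [Category.{v₂} B]

/-- The cone with apex `Y` over the diagram of all `K.obj a` under `Y`, whose leg at
`g : Y ⟶ K.obj a` is `g`. -/
def tautologicalCone (K : A ⥤ B) (Y : B) : Cone (StructuredArrow.proj Y K ⋙ K) where
  pt := Y
  π :=
    { app j := j.hom
      naturality _ _ φ := (Category.id_comp _).trans (StructuredArrow.w φ).symm }

/-- Codensity of `K` at `Y`, dual to `CategoryTheory.Functor.DenseAt`: the object `Y` is the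
canonical limit of the objects `K.obj a` under it. -/
abbrev CodenseAt (K : A ⥤ B) (Y : B) : Type max u₁ u₂ v₂ :=
  IsLimit (tautologicalCone K Y)

/-- The opposite of a functor that is dense at `Y` is codense at `op Y`. -/
def codenseAtRightOp {D : Aᵒᵖ ⥤ B} {Y : B} (hD : D.DenseAt Y) : CodenseAt D.rightOp (op Y) :=
  let unopCone (s : Cone (StructuredArrow.proj (op Y) D.rightOp ⋙ D.rightOp)) :
      Cocone (CostructuredArrow.proj D Y ⋙ D) :=
    { pt := s.pt.unop
      ι :=
        { app j := (s.π.app (StructuredArrow.mk (Y := j.left.unop) j.hom.op)).unop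
          naturality j j' φ := by
            let ψ : StructuredArrow.mk (T := D.rightOp) (Y := j'.left.unop) j'.hom.op ⟶
                StructuredArrow.mk (Y := j.left.unop) j.hom.op :=
              StructuredArrow.homMk φ.left.unop (congrArg Quiver.Hom.op (CostructuredArrow.w φ))
            exact (congrArg Quiver.Hom.unop (s.w ψ)).trans (Category.comp_id _).symm } }
  { lift s := (hD.desc (unopCone s)).op
    fac s j := Quiver.Hom.unop_inj <|
      (congrArg (· ≫ hD.desc (unopCone s)) (Category.id_comp j.hom.unop)).symm.trans
        (hD.fac (unopCone s) (CostructuredArrow.mk (Y := op j.right) j.hom.unop))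
    uniq s m hm := Quiver.Hom.unop_inj <| hD.uniq (unopCone s) m.unop fun j =>
      (congrArg (· ≫ m.unop) (Category.id_comp j.hom)).trans
        (congrArg Quiver.Hom.unop (hm (StructuredArrow.mk (Y := j.left.unop) j.hom.op))) }

end Codense

section Adjunction

universe v₃ u₃

variable {A : Type u₁} [Category.{v₁} A] {B : Type u₂} [Category.{v₂} B]
  {C : Type u₃} [Category.{v₃} C] {F : A ⥤ C} {K : A ⥤ B} {L : C ⥤ B} {R : B ⥤ C}

section Legs

variable (adj : L ⊣ R) (i : K ⋙ R ≅ F)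

/-- When `F` is `K` followed by the right adjoint `R` of `L`, this is the adjunction bijection: `L`
is left adjoint to `F` relative to `K`. -/
def relHomEquiv (X : C) (a : A) : (L.obj X ⟶ K.obj a) ≃ (X ⟶ F.obj a) :=
  (adj.homEquiv X (K.obj a)).trans (i.app a).homToEquiv

theorem relHomEquiv_comp_map {X : C} {a a' : A} (g : L.obj X ⟶ K.obj a) (k : a ⟶ a') :
    relHomEquiv adj i X a' (g ≫ K.map k) = relHomEquiv adj i X a g ≫ F.map k := by
  have h := i.hom.naturality k
  simp only [Functor.comp_map] at h
  simp [relHomEquiv, adj.homEquiv_naturality_right, h]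

theorem map_comp_relHomEquiv_symm {X Y : C} {a : A} (f : X ⟶ Y) (g : Y ⟶ F.obj a) :
    L.map f ≫ (relHomEquiv adj i Y a).symm g = (relHomEquiv adj i X a).symm (f ≫ g) := by
  simp [relHomEquiv, adj.homEquiv_naturality_left_symm]

/-- The leg at `f : X ⟶ F.obj a` of the cone that exhibits `R.obj (L.obj X)` as the value at `X` of
the right Kan extension of `F` along itself: the image under `R` of the transpose of `f`. -/
def ranLeg {X : C} {a : A} (f : X ⟶ F.obj a) : R.obj (L.obj X) ⟶ F.obj a :=
  R.map ((relHomEquiv adj i X a).symm f) ≫ i.hom.app a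

theorem comp_ranLeg {X Y : C} {a : A} (m : Y ⟶ R.obj (L.obj X)) (f : X ⟶ F.obj a) :
    m ≫ ranLeg adj i f =
      relHomEquiv adj i Y a ((adj.homEquiv Y _).symm m ≫ (relHomEquiv adj i X a).symm f) := by
  simp [ranLeg, relHomEquiv, adj.homEquiv_naturality_right]

theorem map_comp_ranLeg {X Y : C} {a : A} (f : X ⟶ Y) (g : Y ⟶ F.obj a) :
    R.map (L.map f) ≫ ranLeg adj i g = ranLeg adj i (f ≫ g) := by
  rw [ranLeg, ranLeg, ← R.map_comp_assoc, map_comp_relHomEquiv_symm]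

theorem ranLeg_comp_map {X : C} {a a' : A} (f : X ⟶ F.obj a) (k : a ⟶ a') :
    ranLeg adj i f ≫ F.map k = ranLeg adj i (f ≫ F.map k) := by
  have symm_comp : (relHomEquiv adj i X a').symm (f ≫ F.map k) =
      (relHomEquiv adj i X a).symm f ≫ K.map k := by
    rw [Equiv.symm_apply_eq, relHomEquiv_comp_map, Equiv.apply_symm_apply]
  have h := i.hom.naturality k
  simp only [Functor.comp_map] at h
  rw [ranLeg, ranLeg, symm_comp, R.map_comp, Category.assoc, Category.assoc, h]

theorem unit_comp_ranLeg {X : C} {a : A} (f : X ⟶ F.obj a) :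
    adj.unit.app X ≫ ranLeg adj i f = f :=
  (comp_ranLeg adj i _ f).trans (by simp)

theorem map_counit_comp_ranLeg {X : C} {a : A} (f : X ⟶ F.obj a) :
    R.map (adj.counit.app (L.obj X)) ≫ ranLeg adj i f = ranLeg adj i (ranLeg adj i f) := by
  have counit_comp : adj.counit.app (L.obj X) ≫ (relHomEquiv adj i X a).symm f =
      (relHomEquiv adj i _ a).symm (ranLeg adj i f) := by
    rw [Equiv.eq_symm_apply, ← adj.homEquiv_symm_id]
    exact (comp_ranLeg adj i (𝟙 _) f).symm.trans (Category.id_comp _)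
  calc R.map (adj.counit.app (L.obj X)) ≫ ranLeg adj i f
      = R.map (adj.counit.app (L.obj X) ≫ (relHomEquiv adj i X a).symm f) ≫ i.hom.app a :=
        (R.map_comp_assoc _ _ _).symm
    _ = ranLeg adj i (ranLeg adj i f) := by rw [counit_comp]; rfl

/-- The counit that makes `L ⋙ R` a right Kan extension of `F` along itself. -/
def adjunctionRanCounit : F ⋙ L ⋙ R ⟶ F where
  app a := ranLeg adj i (𝟙 (F.obj a))
  naturality a b k := by
    refine (map_comp_ranLeg adj i (F.map k) (𝟙 _)).trans ?_
    rw [ranLeg_comp_map, Category.comp_id, Category.id_comp]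

/-- The functor `L ⋙ R` as a right extension of `F` along itself. -/
abbrev adjunctionRightExtension : F.RightExtension F :=
  Functor.RightExtension.mk (L ⋙ R) (adjunctionRanCounit adj i)

theorem adjunctionRightExtension_coneAt_π_app {X : C} (j : StructuredArrow X F) :
    ((adjunctionRightExtension adj i).coneAt X).π.app j = ranLeg adj i j.hom :=
  (map_comp_ranLeg adj i j.hom (𝟙 _)).trans (congrArg _ (Category.comp_id _))

end Legs

section Lift

variable {X : C} (s : Cone (StructuredArrow.proj X F ⋙ F))

/-- The leg of a cone at `f : X ⟶ F.obj a`. -/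
def leg {a : A} (f : X ⟶ F.obj a) : s.pt ⟶ F.obj a :=
  s.π.app (StructuredArrow.mk f)

theorem leg_comp_map {a a' : A} (f : X ⟶ F.obj a) (k : a ⟶ a') :
    leg s (f ≫ F.map k) = leg s f ≫ F.map k :=
  (s.w (StructuredArrow.homMk k : StructuredArrow.mk f ⟶ StructuredArrow.mk (f ≫ F.map k))).symm

variable (adj : L ⊣ R) (i : K ⋙ R ≅ F)

/-- The cone over the objects `K.obj a` under `L.obj X` whose legs are the transposes of those of
`s`. -/
def transposeCone : Cone (StructuredArrow.proj (L.obj X) K ⋙ K) where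
  pt := L.obj s.pt
  π :=
    { app j := (relHomEquiv adj i s.pt j.right).symm (leg s (relHomEquiv adj i X j.right j.hom))
      naturality j j' φ := by
        refine (Category.id_comp _).trans ((Equiv.symm_apply_eq _).2 ?_)
        rw [← StructuredArrow.w φ, relHomEquiv_comp_map, leg_comp_map]
        refine .trans ?_ (relHomEquiv_comp_map adj i _ φ.right).symm
        rw [Equiv.apply_symm_apply] }

/-- The factorisation of the cone `s` through the legs `ranLeg adj i`: the transpose of the
factorisation of the transposed cone provided by codensity. -/
def liftOfCodense (hX : CodenseAt K (L.obj X)) : s.pt ⟶ R.obj (L.obj X) :=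
  adj.homEquiv s.pt (L.obj X) (hX.lift (transposeCone s adj i))

theorem liftOfCodense_comp_ranLeg (hX : CodenseAt K (L.obj X)) {a : A} (f : X ⟶ F.obj a) :
    liftOfCodense s adj i hX ≫ ranLeg adj i f = leg s f := by
  have lift_comp : hX.lift (transposeCone s adj i) ≫ (relHomEquiv adj i X a).symm f =
      (relHomEquiv adj i s.pt a).symm (leg s f) :=
    (hX.fac _ (.mk ((relHomEquiv adj i X a).symm f))).trans <|
      congrArg (fun f => (relHomEquiv adj i s.pt a).symm (leg s f)) (Equiv.apply_symm_apply _ f)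
  refine (comp_ranLeg adj i _ f).trans ((Equiv.eq_symm_apply _).1 (.trans ?_ lift_comp))
  exact congrArg (· ≫ (relHomEquiv adj i X a).symm f) (Equiv.symm_apply_apply _ _)

theorem eq_liftOfCodense (hX : CodenseAt K (L.obj X)) (m : s.pt ⟶ R.obj (L.obj X))
    (hm : ∀ (a : A) (f : X ⟶ F.obj a), m ≫ ranLeg adj i f = leg s f) :
    m = liftOfCodense s adj i hX := by
  refine (Equiv.symm_apply_eq _).1 (hX.uniq (transposeCone s adj i) _ fun j => ?_)
  refine (Equiv.eq_symm_apply _).2 ?_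
  rw [← hm, comp_ranLeg, Equiv.symm_apply_apply]
  rfl

end Lift

variable (adj : L ⊣ R) (i : K ⋙ R ≅ F) (hK : ∀ Y, CodenseAt K Y)

/-- If `F` is a codense functor `K` followed by the right adjoint of `L`, then `L ⋙ R` is a
pointwise right Kan extension of `F` along itself. -/
def adjunctionRightExtensionIsPointwise :
    (adjunctionRightExtension adj i).IsPointwiseRightKanExtension := fun X =>
  { lift s := liftOfCodense s adj i (hK (L.obj X))
    fac s j := by
      rw [adjunctionRightExtension_coneAt_π_app]
      exact liftOfCodense_comp_ranLeg s adj i _ j.hom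
    uniq s m hm := eq_liftOfCodense s adj i _ m fun a f =>
      (congrArg (m ≫ ·) (adjunctionRightExtension_coneAt_π_app adj i (.mk f))).symm.trans
        (hm (.mk f)) }

/-- If `F` is a codense functor followed by the right adjoint of an adjunction, then the monad of
the adjunction is the codensity monad of `F`. -/
def toMonadIsoCodensityMonad [F.HasRightKanExtension F] : adj.toMonad ≅ codensityMonad F :=
  have : adj.toMonad.toFunctor.IsRightKanExtension (adjunctionRanCounit adj i) :=
    (adjunctionRightExtensionIsPointwise adj i hK).isRightKanExtension
  codensityMonadIso F adj.toMonad (adjunctionRanCounit adj i)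
    (fun _ => unit_comp_ranLeg adj i _)
    (fun _ => (map_counit_comp_ranLeg adj i _).trans <| .symm <|
      (map_comp_ranLeg adj i _ _).trans (congrArg _ (Category.comp_id _)))

end Adjunction

section Density

section HomOfPair

variable {G Y Z : CommGrpCat.{u}} (e : Multiplicative ℤ × Multiplicative ℤ ≃* G)

/-- The homomorphism out of a free abelian group on two generators that sends the generators to
`x` and `y`. -/
def homOfPair (x y : Y) : G ⟶ Y :=
  CommGrpCat.ofHom (((zpowersHom Y x).coprod (zpowersHom Y y)).comp e.symm.toMonoidHom)

theorem homOfPair_apply (x y : Y) (m n : Multiplicative ℤ) :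
    homOfPair e x y (e (m, n)) = x ^ m.toAdd * y ^ n.toAdd := by
  simp [homOfPair]

theorem homOfPair_comp (x y : Y) (f : Y ⟶ Z) :
    homOfPair e x y ≫ f = homOfPair e (f x) (f y) := by
  ext z
  obtain ⟨⟨m, n⟩, rfl⟩ := e.surjective z
  simp [homOfPair_apply]

end HomOfPair

variable {A : Type u₁} [Category.{v₁} A] {D : A ⥤ CommGrpCat.{u}} {Y : CommGrpCat.{u}}

section Desc

variable (s : Cocone (CostructuredArrow.proj D Y ⋙ D))

/-- The leg of a cocone at `f : D.obj a ⟶ Y`. -/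
def coleg {a : A} (f : D.obj a ⟶ Y) : D.obj a ⟶ s.pt :=
  s.ι.app (CostructuredArrow.mk f)

variable [D.Full]

theorem comp_coleg {a a' : A} (g : D.obj a ⟶ D.obj a') (f : D.obj a' ⟶ Y) :
    g ≫ coleg s f = coleg s (g ≫ f) := by
  obtain ⟨k, rfl⟩ := D.map_surjective g
  exact s.w (CostructuredArrow.homMk k : CostructuredArrow.mk (D.map k ≫ f) ⟶ .mk f)

variable {a : A} (e : Multiplicative ℤ × Multiplicative ℤ ≃* D.obj a)

theorem coleg_homOfPair_one {a' : A} (f : D.obj a' ⟶ Y) (z : D.obj a') :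
    coleg s (homOfPair e (f z) 1) (e (.ofAdd 1, 1)) = coleg s f z := by
  have h := homOfPair_comp e z 1 f
  rw [map_one] at h
  rw [← h, ← comp_coleg]
  simp [homOfPair_apply]

/-- The factorisation of the cocone `s` through `Y`. It is multiplicative because
`homOfPair e x y` takes the values `x`, `y` and `x * y`. -/
def descOfPair : Y ⟶ s.pt :=
  CommGrpCat.ofHom <| MonoidHom.mk' (fun y => coleg s (homOfPair e y 1) (e (.ofAdd 1, 1)))
    fun x y => by
      have h (z : D.obj a) := coleg_homOfPair_one s e (homOfPair e x y) z
      have hx : homOfPair e x y (e (.ofAdd 1, 1)) = x := by simp [homOfPair_apply]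
      have hy : homOfPair e x y (e (1, .ofAdd 1)) = y := by simp [homOfPair_apply]
      have hxy : homOfPair e x y (e (.ofAdd 1, 1) * e (1, .ofAdd 1)) = x * y := by
        rw [map_mul, hx, hy]
      have h₁ := h (e (.ofAdd 1, 1))
      have h₂ := h (e (1, .ofAdd 1))
      rw [hx] at h₁
      rw [hy] at h₂
      rw [h₁, h₂, ← hxy, h, map_mul]

theorem comp_descOfPair {a' : A} (f : D.obj a' ⟶ Y) : f ≫ descOfPair s e = coleg s f := by
  ext z
  exact coleg_homOfPair_one s e f z

end Desc

/-- A full functor to abelian groups that takes a free abelian group on two generators as a value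
is dense. -/
def denseAtOfFull [D.Full] {a : A} (e : Multiplicative ℤ × Multiplicative ℤ ≃* D.obj a) :
    D.DenseAt Y where
  desc s := descOfPair s e
  fac s j :=
    (congrArg (· ≫ descOfPair s e) (Category.id_comp j.hom)).trans (comp_descOfPair s e j.hom)
  uniq s m hm := by
    have comp_m {a' : A} (f : D.obj a' ⟶ Y) : f ≫ m = coleg s f :=
      (congrArg (· ≫ m) (Category.id_comp f)).symm.trans (hm (.mk f))
    ext y
    have hy : homOfPair e y 1 (e (.ofAdd 1, 1)) = y := by simp [homOfPair_apply]
    exact (congrArg m hy).symm.trans (ConcreteCategory.congr_hom (comp_m (homOfPair e y 1)) _)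

end Density

section CircleCharacters

variable {T : ℝ} [Fact (0 < T)]

theorem exists_fourierCoeff_ne_zero {f : C(AddCircle T, ℂ)} (hf : f ≠ 0) :
    ∃ n, fourierCoeff f n ≠ 0 := by
  contrapose! hf
  ext x
  have hs := has_pointwise_sum_fourier_series_of_summable (f := f)
    (summable_zero.congr fun n => (hf n).symm) x
  simp only [hf, zero_smul] at hs
  exact hs.unique hasSum_zero

theorem fourierCoeff_comp_add_left {E : Type*} [NormedAddCommGroup E] [NormedSpace ℂ E]
    (f : AddCircle T → E) (y : AddCircle T) (n : ℤ) :
    fourierCoeff (fun x => f (y + x)) n = fourier n y • fourierCoeff f n := by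
  rw [fourierCoeff, fourierCoeff, ← MeasureTheory.integral_smul,
    ← MeasureTheory.integral_add_left_eq_self _ (-y)]
  refine MeasureTheory.integral_congr_ae (.of_forall fun x => ?_)
  simp [fourier_apply, smul_smul, AddCircle.toCircle_add]

theorem exists_eq_fourier (χ : AddChar (AddCircle T) ℂ) (hχ : Continuous χ) :
    ∃ n : ℤ, ∀ x, χ x = fourier n x := by
  have χ_ne_zero : (⟨χ, hχ⟩ : C(AddCircle T, ℂ)) ≠ 0 := fun h =>
    one_ne_zero ((AddChar.map_zero_eq_one χ).symm.trans (DFunLike.congr_fun h 0))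
  obtain ⟨n, hn⟩ := exists_fourierCoeff_ne_zero χ_ne_zero
  refine ⟨n, fun y => mul_right_cancel₀ hn ?_⟩
  calc χ y * fourierCoeff χ n = fourierCoeff (fun x => χ (y + x)) n := by
        simp only [AddChar.map_add_eq_mul, ← fourierCoeff.const_mul]
    _ = fourier n y * fourierCoeff χ n := fourierCoeff_comp_add_left χ y n

theorem exists_eq_zpow (χ : Circle →ₜ* Circle) : ∃ n : ℤ, ∀ z, χ z = z ^ n := by
  have : Fact ((0 : ℝ) < 1) := ⟨one_pos⟩
  let ψ : AddChar (AddCircle (1 : ℝ)) ℂ :=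
    { toFun x := χ x.toCircle
      map_zero_eq_one' := by simp
      map_add_eq_mul' := by simp [AddCircle.toCircle_add] }
  have hψ : Continuous fun x : AddCircle (1 : ℝ) => (χ x.toCircle : ℂ) := by fun_prop
  obtain ⟨n, hn⟩ := exists_eq_fourier ψ hψ
  refine ⟨n, fun z => ?_⟩
  obtain ⟨x, rfl⟩ := (AddCircle.homeomorphCircle (one_ne_zero' ℝ)).surjective z
  rw [AddCircle.homeomorphCircle_apply, ← AddCircle.toCircle_zsmul]
  exact Circle.ext (hn x)

theorem eq_zero_of_forall_zpow_eq_one {n : ℤ} (h : ∀ z : Circle, z ^ n = 1) : n = 0 := by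
  by_contra hn
  have hn' : (n : ℝ) ≠ 0 := Int.cast_ne_zero.2 hn
  refine Circle.exp_pi_ne_one ?_
  rw [← h (Circle.exp (Real.pi / n)), ← Circle.exp_zsmul, zsmul_eq_mul, mul_div_cancel₀ _ hn']

end CircleCharacters

section TorusCharacters

/-- Evaluation of the continuous characters of `G`, as a homomorphism from `G` to the group of all
characters of its Pontryagin dual. -/
def evalDual (G : Type*) [Monoid G] [TopologicalSpace G] : G →* PontryaginDual G →* Circle where
  toFun x :=
    { toFun χ := χ x
      map_one' := rfl
      map_mul' _ _ := rfl }
  map_one' := MonoidHom.ext fun χ => map_one χ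
  map_mul' x y := MonoidHom.ext fun χ => map_mul χ x y

theorem zpow_mul_zpow_apply {G : Type*} [Monoid G] [TopologicalSpace G]
    (χ ψ : PontryaginDual G) (m n : ℤ) (x : G) : (χ ^ m * ψ ^ n) x = χ x ^ m * ψ x ^ n := by
  have h := map_mul (evalDual G x) (χ ^ m) (ψ ^ n)
  rwa [map_zpow, map_zpow] at h

/-- The first coordinate character of the torus. -/
def torusFst : PontryaginDual torus.{u}.carrier where
  toFun z := (z : ULift (Circle × Circle)).down.1
  map_one' := rfl
  map_mul' _ _ := rfl
  continuous_toFun := continuous_fst.comp continuous_uliftDown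

/-- The second coordinate character of the torus. -/
def torusSnd : PontryaginDual torus.{u}.carrier where
  toFun z := (z : ULift (Circle × Circle)).down.2
  map_one' := rfl
  map_mul' _ _ := rfl
  continuous_toFun := continuous_snd.comp continuous_uliftDown

theorem torus_ext {z w : torus.{u}.carrier} (h₁ : torusFst z = torusFst w)
    (h₂ : torusSnd z = torusSnd w) : z = w :=
  ULift.ext _ _ (Prod.ext h₁ h₂)

/-- The continuous homomorphism into the torus with the given coordinates. -/
def torusPair {G : Type*} [Monoid G] [TopologicalSpace G] (χ ψ : PontryaginDual G) :
    G →ₜ* torus.{u}.carrier where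
  toFun x := ULift.up (χ x, ψ x)
  map_one' := torus_ext (map_one χ) (map_one ψ)
  map_mul' x y := torus_ext (map_mul χ x y) (map_mul ψ x y)
  continuous_toFun := continuous_uliftUp.comp ((map_continuous χ).prodMk (map_continuous ψ))

/-- The inclusion of the first factor of the torus. -/
def torusInl : Circle →ₜ* torus.{u}.carrier :=
  torusPair (ContinuousMonoidHom.id Circle) (1 : PontryaginDual Circle)

/-- The inclusion of the second factor of the torus. -/
def torusInr : Circle →ₜ* torus.{u}.carrier :=
  torusPair (1 : PontryaginDual Circle) (ContinuousMonoidHom.id Circle)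

theorem exists_eq_torusFst_zpow_mul_torusSnd_zpow (χ : PontryaginDual torus.{u}.carrier) :
    ∃ m n : ℤ, χ = torusFst ^ m * torusSnd ^ n := by
  obtain ⟨m, hm⟩ := exists_eq_zpow (ContinuousMonoidHom.comp χ torusInl)
  obtain ⟨n, hn⟩ := exists_eq_zpow (ContinuousMonoidHom.comp χ torusInr)
  refine ⟨m, n, PontryaginDual.ext fun z => ?_⟩
  have hz : z = torusInl (torusFst z) * torusInr (torusSnd z) :=
    torus_ext (mul_one _).symm (one_mul _).symm
  calc χ z = χ (torusInl (torusFst z)) * χ (torusInr (torusSnd z)) := by rw [← map_mul, ← hz]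
    _ = torusFst z ^ m * torusSnd z ^ n := congrArg₂ (· * ·) (hm _) (hn _)
    _ = (torusFst ^ m * torusSnd ^ n) z := (zpow_mul_zpow_apply ..).symm

theorem eq_zero_of_torusFst_zpow_mul_torusSnd_zpow_eq_one {m n : ℤ}
    (h : torusFst.{u} ^ m * torusSnd ^ n = 1) : m = 0 ∧ n = 0 := by
  have hz (z : torus.{u}.carrier) : torusFst z ^ m * torusSnd z ^ n = 1 := by
    rw [← zpow_mul_zpow_apply, h, PontryaginDual.one_apply]
  have hm (z : Circle) : z ^ m = 1 := by
    have h : z ^ m * 1 ^ n = 1 := hz (torusInl z)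
    rwa [one_zpow, mul_one] at h
  have hn (z : Circle) : z ^ n = 1 := by
    have h : 1 ^ m * z ^ n = 1 := hz (torusInr z)
    rwa [one_zpow, one_mul] at h
  exact ⟨eq_zero_of_forall_zpow_eq_one hm, eq_zero_of_forall_zpow_eq_one hn⟩

/-- The Pontryagin dual of the torus is free abelian on the two coordinates. -/
def torusDualEquiv : Multiplicative ℤ × Multiplicative ℤ ≃* PontryaginDual torus.{u}.carrier :=
  MulEquiv.ofBijective ((zpowersHom _ torusFst).coprod (zpowersHom _ torusSnd))
    ⟨(injective_iff_map_eq_one _).2 fun _ h =>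
        have ⟨hm, hn⟩ := eq_zero_of_torusFst_zpow_mul_torusSnd_zpow_eq_one h
        Prod.ext hm hn,
      fun χ =>
        have ⟨m, n, h⟩ := exists_eq_torusFst_zpow_mul_torusSnd_zpow χ
        ⟨(.ofAdd m, .ofAdd n), h.symm⟩⟩

theorem torusDual_hom_ext {H : Type*} [Group H] {φ ψ : PontryaginDual torus.{u}.carrier →* H}
    (h₁ : φ torusFst = ψ torusFst) (h₂ : φ torusSnd = ψ torusSnd) : φ = ψ := by
  ext χ
  obtain ⟨m, n, rfl⟩ := exists_eq_torusFst_zpow_mul_torusSnd_zpow χ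
  simp only [map_mul, map_zpow, h₁, h₂]

theorem evalDual_torus_bijective : Function.Bijective (evalDual torus.{u}.carrier) :=
  ⟨fun _ _ h => torus_ext (DFunLike.congr_fun h torusFst) (DFunLike.congr_fun h torusSnd),
    fun ξ => ⟨ULift.up (ξ torusFst, ξ torusSnd), torusDual_hom_ext rfl rfl⟩⟩

end TorusCharacters

section TorusDual

/-- The functor of continuous characters `G ↦ CHAb(G, S¹)`, with values in discrete abelian
groups. -/
def pontryaginDual : CHAb.{u}ᵒᵖ ⥤ CommGrpCat.{u} where
  obj G := CommGrpCat.of (PontryaginDual G.unop.carrier)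
  map f := CommGrpCat.ofHom (PontryaginDual.map f.unop).toMonoidHom

/-- The restriction of the functor of continuous characters to the one-object category of the
torus. -/
def torusDual : TorusCat.{u}ᵒᵖ ⥤ CommGrpCat.{u} :=
  (inducedFunctor _).op ⋙ pontryaginDual

instance : torusDual.{u}.Full where
  map_surjective φ :=
    ⟨(InducedCategory.homMk (torusPair (φ.hom torusFst) (φ.hom torusSnd))).op,
      CommGrpCat.hom_ext (torusDual_hom_ext rfl rfl)⟩

/-- The opposite of `torusDual` is codense in `Abᵒᵖ`. -/
def torusDualCodenseAt (Y : CommGrpCat.{u}ᵒᵖ) : CodenseAt torusDual.{u}.rightOp Y :=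
  codenseAtRightOp (denseAtOfFull (a := op ()) torusDualEquiv)

/-- The torus as the group of all characters of its Pontryagin dual. -/
def torusDualCompDualIso : torusDual.{u}.rightOp ⋙ dual ≅ torusForget :=
  (NatIso.ofComponents
    (fun _ => (MulEquiv.ofBijective _ evalDual_torus_bijective).toCommGrpIso) fun _ => rfl).symm

end TorusDual

end Codensity

end

theorem mainTheorem9 :
    ∃ _ : Codensity.torusForget.{u}.HasPointwiseRightKanExtension Codensity.torusForget.{u},
      Nonempty (Codensity.doubleDualizationMonad.{u} ≅
        Codensity.codensityMonad Codensity.torusForget.{u}) := by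
  have hasRan : Codensity.torusForget.{u}.HasPointwiseRightKanExtension Codensity.torusForget :=
    (Codensity.adjunctionRightExtensionIsPointwise Codensity.dualAdjunction
      Codensity.torusDualCompDualIso Codensity.torusDualCodenseAt).hasPointwiseRightKanExtension
  exact ⟨hasRan, ⟨Codensity.toMonadIsoCodensityMonad Codensity.dualAdjunction
    Codensity.torusDualCompDualIso Codensity.torusDualCodenseAt⟩⟩
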